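/- Theorem (Equivariant normal form, general version). All manifolds are Hausdorff, smooth and modeled on real Hausdorff locally convex spaces (the model space may vary from chart to chart), smoothness is understood in the sense of Michal–Bastiani, and a chart at a point sends that point to $0$. A submanifold $S\subseteq M$ is a subset such that each of its points lies in the domain $O$ of a chart $\kappa: M \supseteq O\to X$ with $\kappa(O\cap S)=\kappa(O)\cap E$ for a closed subspace $E\subseteq X$; a Lie subgroup is a subgroup that is a submanifold; it is principal if $G\to G/H$ is a smooth locally trivial principal bundle. An action is proper if preimages of compact sets under $(g,x)\mapsto(g\cdot x,x)$ are compact. A *slice* at $m$ for a smooth action of a Lie group $K$ on $M$ is a submanifold $S\ni m$ such that: (SL1) $K_m\cdot S\subseteq S$; (SL2) $g\cdot S\cap S\neq\emptyset$ implies $g\in K_m$; (SL3) the stabilizer $K_m$ is a principal Lie subgroup of $K$, and $K\to K/K_m$ has a smooth local section $\chi$ on an open neighborhood $O$ of $[e]$ such that $O\times S\to M$, $([g],s)\mapsto\chi([g])\cdot s$, is a diffeomorphism onto an open neighborhood of $m$; (SL4) $\{s\in S: K_s \text{ is conjugate to } K_m\}$ is a closed submanifold of $S$; (SL5) there is a $K_m$-equivariant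 diffeomorphism from an open $K_m$-invariant neighborhood of $0$ in a continuous linear representation of $K_m$ on a locally convex space onto $S$, sending $0$ to $m$. For a topological group $H$, an *$H$-equivariant normal form* $(X,Y,\hat f,f_{\mathrm{sing}})$ consists of locally convex spaces $X,Y$ with continuous linear $H$-actions and $H$-invariant topological decompositions $X=\mathrm{Ker}\oplus\mathrm{Coim}$, $Y=\mathrm{Coker}\oplus\mathrm{Im}$, an $H$-equivariant linear topological isomorphism $\hat f:\mathrm{Coim}\to\mathrm{Im}$, and a smooth $H$-equivariant map $f_{\mathrm{sing}}:U\to\mathrm{Coker}$ on an $H$-invariant open neighborhood $U$ of $0$ in $X$ with $f_{\mathrm{sing}}(0,x_2)=0$ for all $x_2\in U\cap\mathrm{Coim}$ and $T_0f_{\mathrm{sing}}=0$. Put $f_{\mathrm{NF}}(x_1,x_2)=\hat f(x_2)+f_{\mathrm{sing}}(x_1,x_2)$ for $(x_1,x_2)\in U$. Let $G$ be a locally convex Lie group, let $M$ and $N$ be Fréchet manifolds with smooth $G$-actions, and let $f:M\to N$ be a smooth $G$-equivariant map. Let $m\in M$ and $\mu=f(m)$, with stabilizers $G_m\subseteq G_\mu$.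 Assume: 1. $G_\mu$ is a Lie subgroup of $G$. 2. The induced $G_\mu$-action on $M$ is proper and admits a slice $S$ at $m$. 3. The $G_m$-action on $N$ can be linearized at $\mu$: there is a chart of $N$ at $\mu$, with $G_m$-invariant domain, that is equivariant for a continuous linear $G_m$-action on its model space. 4. $f|_S:S\to N$ can be brought into a normal form at $m$ in a $G_m$-equivariant way: there are a $G_m$-equivariant normal form $(X,Y,\hat f,f_{\mathrm{sing}})$ with domain $U$, and charts $\kappa:S\supseteq U'\to U\subseteq X$ at $m$ and $\rho:N\supseteq V'\to V\subseteq Y$ at $\mu$, with $G_m$-invariant domains and $G_m$-equivariant, such that $f(U')\subseteq V'$ and $\rho\circ f|_{U'}=f_{\mathrm{NF}}\circ\kappa$. Then $f$ can be brought into an equivariant normal form at $m$, that is: $G_m$ is a compact Lie subgroup of $G_\mu$, and there exist a $G_m$-equivariant normal form $(X,Y,\hat f,f_{\mathrm{sing}})$ with domain $U$, a slice $S'$ at $m$ for the $G_\mu$-action, a $G_m$-equivariant diffeomorphism $\iota:X\supseteq U\to S'$ with $\iota(0)=m$, and a $G_m$-equivariant chart $\rho:N\supseteq V'\to V\subseteq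 Y$ at $\mu$ with $f(S')\subseteq V'$ and $f_{\mathrm{NF}}(U)\subseteq V$, such that $$ f\circ\chi^T\circ(\mathrm{id}\times_{G_m}\iota)=\rho^T\circ F \quad\text{on } G_\mu\times_{G_m}U, $$ where $F:G_\mu\times_{G_m}U\to G_\mu\times_{G_m}V$, $F([g,x_1,x_2])=[g,\hat f(x_2)+f_{\mathrm{sing}}(x_1,x_2)]$, and $\chi^T:G_\mu\times_{G_m}S'\to M$, $[g,s]\mapsto g\cdot s$, and $\rho^T:G_\mu\times_{G_m}V\to N$, $[g,y]\mapsto g\cdot\rho^{-1}(y)$. -/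

import Mathlib

open Set Filter Topology

universe u v w

namespace LocConvex

/-! ## Locally convex spaces and Michal–Bastiani calculus -/

/-- A real Hausdorff locally convex topological vector space. -/
structure LCS : Type (u + 1) where
  carrier : Type u
  [instAddCommGroup : AddCommGroup carrier]
  [instModule : Module ℝ carrier]
  [instTopologicalSpace : TopologicalSpace carrier]
  [instIsTopologicalAddGroup : IsTopologicalAddGroup carrier]
  [instContinuousSMul : ContinuousSMul ℝ carrier]
  [instLocallyConvexSpace : LocallyConvexSpace ℝ carrier]
  [instT2Space : T2Space carrier]

instance : CoeSort LCS.{u} (Type u) := ⟨LCS.carrier⟩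

attribute [instance] LCS.instAddCommGroup LCS.instModule LCS.instTopologicalSpace
  LCS.instIsTopologicalAddGroup LCS.instContinuousSMul LCS.instLocallyConvexSpace
  LCS.instT2Space

/-- The product of two locally convex spaces. -/
abbrev LCS.prod (E : LCS.{u}) (F : LCS.{v}) : LCS.{max u v} := ⟨E × F⟩

/-- A Fréchet space: a complete metrizable locally convex space. -/
def LCS.IsFrechet (E : LCS.{u}) : Prop :=
  TopologicalSpace.MetrizableSpace E ∧
    @CompleteSpace E (IsTopologicalAddGroup.leftUniformSpace E)

section Calculus

/-- The directional derivative of `f` at `x` in direction `a` exists and equals `b`. -/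
def HasDirDeriv {E : Type u} {F : Type v} [AddCommGroup E] [Module ℝ E]
    [AddCommGroup F] [Module ℝ F] [TopologicalSpace F] (f : E → F) (x a : E) (b : F) : Prop :=
  Tendsto (fun t : ℝ => t⁻¹ • (f (x + t • a) - f x)) (𝓝[≠] 0) (𝓝 b)

/-- `f` is of class `C^n` on the open set `U`: it is continuous and, if `n > 0`, all directional
derivatives exist on `U` and `(x, a) ↦ df(x)(a)` is of class `C^(n-1)` on `U × E`. -/
def CkOn : ℕ → ∀ {E : Type u} {F : Type v} [AddCommGroup E] [Module ℝ E] [TopologicalSpace E]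
    [AddCommGroup F] [Module ℝ F] [TopologicalSpace F], (E → F) → Set E → Prop
  | 0, _, _, _, _, _, _, _, _, f, U => ContinuousOn f U
  | n + 1, E, F, _, _, _, _, _, _, f, U => ContinuousOn f U ∧ ∃ df : E × E → F,
      (∀ x ∈ U, ∀ a, HasDirDeriv f x a (df (x, a))) ∧ CkOn n df (U ×ˢ (univ : Set E))

/-- `f` is smooth on the open set `U`. -/
def SmoothOn {E : Type u} {F : Type v} [AddCommGroup E] [Module ℝ E] [TopologicalSpace E]
    [AddCommGroup F] [Module ℝ F] [TopologicalSpace F] (f : E → F) (U : Set E) : Prop :=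
  ∀ n, CkOn n f U

end Calculus

/-! ## Manifolds

The model space may vary from chart to chart. -/

/-- A chart with values in some locally convex space. -/
structure LCChart (M : Type u) [TopologicalSpace M] : Type (u + 1) where
  model : LCS.{u}
  map : OpenPartialHomeomorph M model

/-- An atlas (as data; its compatibility is the predicate `IsLCManifold`). -/
class LCCharts (M : Type u) [TopologicalSpace M] : Type (u + 1) where
  charts : Set (LCChart M)

/-- `κ` is a chart of the smooth structure, i.e. smoothly compatible with the given atlas. -/
def IsChart {M : Type u} [TopologicalSpace M] [LCCharts M] (X : LCS.{u})
    (κ : OpenPartialHomeomorph M X) : Prop :=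
  ∀ c ∈ LCCharts.charts (M := M),
    SmoothOn (c.map ∘ κ.symm) (κ.symm.trans c.map).source ∧
      SmoothOn (κ ∘ c.map.symm) (c.map.symm.trans κ).source

/-- Hausdorff smooth manifolds modeled on locally convex spaces. -/
structure IsLCManifold (M : Type u) [TopologicalSpace M] [LCCharts M] : Prop where
  t2 : T2Space M
  cover : ∀ p : M, ∃ c ∈ LCCharts.charts (M := M), p ∈ c.map.source
  compat : ∀ c ∈ LCCharts.charts (M := M), IsChart c.model c.map

/-- Manifolds modeled on Fréchet spaces. -/
structure IsFrechetManifold (M : Type u) [TopologicalSpace M] [LCCharts M] : Prop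
    extends IsLCManifold M where
  frechet : ∀ c ∈ LCCharts.charts (M := M), c.model.IsFrechet

/-- Smoothness of `f` on the open subset `A`: continuity, and smoothness of all chart
representations. -/
def SmoothMapOn {M : Type u} {N : Type v} [TopologicalSpace M] [LCCharts M]
    [TopologicalSpace N] [LCCharts N] (f : M → N) (A : Set M) : Prop :=
  ContinuousOn f A ∧ ∀ c ∈ LCCharts.charts (M := M), ∀ d ∈ LCCharts.charts (M := N),
    SmoothOn (d.map ∘ f ∘ c.map.symm)
      (c.map.target ∩ c.map.symm ⁻¹' (A ∩ f ⁻¹' d.map.source))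

/-- Smooth maps between manifolds. -/
def SmoothMap {M : Type u} {N : Type v} [TopologicalSpace M] [LCCharts M]
    [TopologicalSpace N] [LCCharts N] (f : M → N) : Prop :=
  SmoothMapOn f univ

/-- `f` restricts to a diffeomorphism of the open set `A` onto the open set `B`. -/
def IsDiffeoOn {M : Type u} {N : Type v} [TopologicalSpace M] [LCCharts M]
    [TopologicalSpace N] [LCCharts N] (f : M → N) (A : Set M) (B : Set N) : Prop :=
  IsOpen A ∧ IsOpen B ∧ SmoothMapOn f A ∧ MapsTo f A B ∧
    ∃ g : N → M, SmoothMapOn g B ∧ MapsTo g B A ∧ LeftInvOn g f A ∧ RightInvOn g f B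

/-- The product manifold. -/
instance instProdCharts {M : Type u} {N : Type v} [TopologicalSpace M] [LCCharts M]
    [TopologicalSpace N] [LCCharts N] : LCCharts (M × N) where
  charts := {e | ∃ c ∈ LCCharts.charts (M := M), ∃ d ∈ LCCharts.charts (M := N),
    e = ⟨c.model.prod d.model, c.map.prod d.map⟩}

/-! ## Submanifolds -/

/-- `κ` is a chart adapted to the subset `S`: `κ(U ∩ S) = κ(U) ∩ Y`, where `U` is the domain
of `κ` and `Y` is a closed subspace of the model space. -/
def IsAdapted {M : Type u} [TopologicalSpace M] [LCCharts M] (S : Set M) (κ : LCChart M)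
    (Y : Submodule ℝ κ.model) : Prop :=
  IsChart κ.model κ.map ∧ IsClosed (Y : Set κ.model) ∧
    κ.map '' (κ.map.source ∩ S) = κ.map.target ∩ (Y : Set κ.model)

/-- Every point of `S` lies in the domain of an adapted chart. -/
def IsSubmanifold {M : Type u} [TopologicalSpace M] [LCCharts M] (S : Set M) : Prop :=
  ∀ s ∈ S, ∃ (κ : LCChart M) (Y : Submodule ℝ κ.model), s ∈ κ.map.source ∧ IsAdapted S κ Y

/-- The atlas that `M` induces on `P` along the inclusion `i : P → M` of a submanifold: the
restrictions of the adapted charts, with values in (a copy of) the closed subspace. -/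
@[reducible]
def inducedCharts {P M : Type u} [TopologicalSpace P] [TopologicalSpace M] [LCCharts M]
    (i : P → M) : LCCharts P where
  charts := {σ | ∃ (κ : LCChart M) (Y : Submodule ℝ κ.model), IsAdapted (range i) κ Y ∧
    σ.map.source = i ⁻¹' κ.map.source ∧
    ∃ e : σ.model ≃L[ℝ] Y, ∀ p ∈ σ.map.source, (e (σ.map p) : κ.model) = κ.map (i p)}

instance instSubsetCharts {M : Type u} [TopologicalSpace M] [LCCharts M] (S : Set M) :
    LCCharts S := inducedCharts (Subtype.val : S → M)

instance instSubgroupCharts {G : Type u} [Group G] [TopologicalSpace G] [LCCharts G]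
    (H : Subgroup G) : LCCharts H := inducedCharts (Subtype.val : H → G)

/-! ## Lie groups and actions -/

/-- Lie groups modeled on locally convex spaces. -/
structure IsLieGroup (G : Type u) [Group G] [TopologicalSpace G] [LCCharts G] : Prop
    extends IsLCManifold G where
  smooth_mul : SmoothMap fun p : G × G => p.1 * p.2
  smooth_inv : SmoothMap fun g : G => g⁻¹

/-- The action `G × M → M` is smooth. -/
def IsSmoothAction (G : Type u) (M : Type v) [Group G] [TopologicalSpace G] [LCCharts G]
    [TopologicalSpace M] [LCCharts M] [MulAction G M] : Prop :=
  SmoothMap fun p : G × M => p.1 • p.2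

/-- Preimages of compact sets under `(g, x) ↦ (g • x, x)` are compact. -/
def IsProperAction (G : Type u) (M : Type v) [Group G] [TopologicalSpace G]
    [TopologicalSpace M] [MulAction G M] : Prop :=
  ∀ C : Set (M × M), IsCompact C → IsCompact ((fun p : G × M => (p.1 • p.2, p.2)) ⁻¹' C)

/-- A Lie subgroup is a subgroup that is a submanifold. -/
def IsLieSubgroup {G : Type u} [Group G] [TopologicalSpace G] [LCCharts G]
    (H : Subgroup G) : Prop :=
  IsSubmanifold (H : Set G)

/-- `H` is a principal Lie subgroup of `G`: with the given smooth structure on `G ⧸ H`, the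
natural fibration `G → G ⧸ H` is a smooth locally trivial principal `H`-bundle. -/
structure IsPrincipalLieSubgroup {G : Type u} [Group G] [TopologicalSpace G] [LCCharts G]
    (H : Subgroup G) [LCCharts (G ⧸ H)] : Prop where
  lie : IsLieSubgroup H
  base : IsLCManifold (G ⧸ H)
  smooth_mk : SmoothMap (QuotientGroup.mk : G → G ⧸ H)
  locally_trivial : ∀ q : G ⧸ H, ∃ (W : Set (G ⧸ H)) (Φ : (G ⧸ H) × H → G), q ∈ W ∧
    IsDiffeoOn Φ (W ×ˢ (univ : Set H)) (QuotientGroup.mk ⁻¹' W) ∧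
    ∀ p ∈ W, ∀ h : H, (QuotientGroup.mk (Φ (p, h)) : G ⧸ H) = p ∧
      ∀ h' : H, Φ (p, h * h') = Φ (p, h) * (h' : G)

/-- A continuous linear representation of `H` on `X`. -/
structure LinRep (H : Type u) [Group H] [TopologicalSpace H] (X : LCS.{v}) where
  toHom : H →* (X →L[ℝ] X)
  continuous_action : Continuous fun p : H × X => toHom p.1 p.2

/-- `κ` is an `H`-equivariant chart at `m` on `P`, where `P` is included by `i` in the
`H`-manifold `M` and `H` acts linearly on the model space: `κ(m) = 0`, the domain of `κ` is
`H`-invariant, and `κ(h • p) = π(h) κ(p)`. (It is used for `P = M` and for `H`-invariant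
submanifolds `P` of `M`.) -/
structure IsEquivChart {H : Type v} {P M : Type u} [Group H] [TopologicalSpace H]
    [TopologicalSpace P] [LCCharts P] [MulAction H M] (i : P → M) (m : M) {X : LCS.{u}}
    (κ : OpenPartialHomeomorph P X) (π : LinRep H X) : Prop where
  isChart : IsChart X κ
  base : ∃ p ∈ κ.source, i p = m ∧ κ p = 0
  equivariant : ∀ h : H, ∀ p ∈ κ.source, ∃ p' ∈ κ.source,
    i p' = h • i p ∧ κ p' = π.toHom h (κ p)

/-- The `H`-action on `M` can be linearized at the fixed point `m`. -/
def IsLinearizableAt (H : Type v) {M : Type u} [Group H] [TopologicalSpace H]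
    [TopologicalSpace M] [LCCharts M] [MulAction H M] (m : M) : Prop :=
  ∃ (X : LCS.{u}) (κ : OpenPartialHomeomorph M X) (π : LinRep H X),
    IsEquivChart (fun p : M => p) m κ π

/-! ## Slices -/

/-- `S` is a slice at `m` for the action of the Lie group `K` on `M`. -/
structure IsSlice (K : Type v) {M : Type u} [Group K] [TopologicalSpace K] [LCCharts K]
    [TopologicalSpace M] [LCCharts M] [MulAction K M] (m : M) (S : Set M) : Prop where
  mem : m ∈ S
  submanifold : IsSubmanifold S
  invariant : ∀ g ∈ MulAction.stabilizer K m, ∀ s ∈ S, g • s ∈ S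
  mem_stabilizer : ∀ g : K, (∃ s ∈ S, g • s ∈ S) → g ∈ MulAction.stabilizer K m
  /-- The stabilizer `K_m` is principal and there is a local section `χ` of `K → K ⧸ K_m` such
  that `([g], s) ↦ χ([g]) • s` is a diffeomorphism onto an open neighborhood of `m`. -/
  local_section : ∃ _ : LCCharts (K ⧸ MulAction.stabilizer K m),
    IsPrincipalLieSubgroup (MulAction.stabilizer K m) ∧
    ∃ (U : Set (K ⧸ MulAction.stabilizer K m)) (χ : K ⧸ MulAction.stabilizer K m → K)
      (V : Set M),
      IsOpen U ∧ ((1 : K) : K ⧸ MulAction.stabilizer K m) ∈ U ∧ SmoothMapOn χ U ∧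
      (∀ q ∈ U, (QuotientGroup.mk (χ q) : K ⧸ MulAction.stabilizer K m) = q) ∧ m ∈ V ∧
      IsDiffeoOn (fun p : (K ⧸ MulAction.stabilizer K m) × S => χ p.1 • (p.2 : M))
        (U ×ˢ (univ : Set S)) V
  /-- The points of `S` whose stabilizer is conjugate to `K_m` form a closed submanifold. -/
  partial_slice :
    let T : Set S := {s | ∃ a : K, MulAction.stabilizer K (s : M) =
      (MulAction.stabilizer K m).map (MulAut.conj a).toMonoidHom}
    IsClosed T ∧ IsSubmanifold T
  /-- `S` is equivariantly diffeomorphic to an open neighborhood of `0` in a linear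
  representation of `K_m`. -/
  linear : ∃ (X : LCS.{u}) (κ : OpenPartialHomeomorph S X)
    (π : LinRep (MulAction.stabilizer K m) X), κ.source = univ ∧
      IsEquivChart (Subtype.val : S → M) m κ π

/-! ## Normal forms -/

/-- The data `(X, Y, f̂, f_sing)` of a normal form that is equivariant under linear actions of
the topological group `H` on `X = Ker ⊕ Coim` and `Y = Coker ⊕ Im`. -/
structure NormalForm (H : Type u) [Group H] [TopologicalSpace H] where
  X : LCS.{v}
  Y : LCS.{w}
  repX : LinRep H X
  repY : LinRep H Y
  Ker : Submodule ℝ X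
  Coim : Submodule ℝ X
  Coker : Submodule ℝ Y
  Im : Submodule ℝ Y
  decompX : Submodule.IsTopCompl Coim Ker
  decompY : Submodule.IsTopCompl Im Coker
  ker_invariant : ∀ h, ∀ x ∈ Ker, repX.toHom h x ∈ Ker
  coim_invariant : ∀ h, ∀ x ∈ Coim, repX.toHom h x ∈ Coim
  coker_invariant : ∀ h, ∀ y ∈ Coker, repY.toHom h y ∈ Coker
  im_invariant : ∀ h, ∀ y ∈ Im, repY.toHom h y ∈ Im
  /-- the isomorphism `f̂ : Coim → Im` -/
  fhat : Coim ≃L[ℝ] Im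
  fhat_equivariant : ∀ h (x : Coim),
    (fhat ⟨repX.toHom h x, coim_invariant h x x.2⟩ : Y) = repY.toHom h (fhat x)
  /-- the domain of `f_sing` -/
  U : Set X
  isOpen_U : IsOpen U
  zero_mem_U : 0 ∈ U
  U_invariant : ∀ h, ∀ x ∈ U, repX.toHom h x ∈ U
  /-- the singular part; only its values on `U` matter -/
  fsing : X → Coker
  fsing_smooth : SmoothOn fsing U
  fsing_equivariant : ∀ h, ∀ x ∈ U, (fsing (repX.toHom h x) : Y) = repY.toHom h (fsing x)
  fsing_coim : ∀ x ∈ Coim, x ∈ U → fsing x = 0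
  fsing_deriv : ∀ a, HasDirDeriv fsing 0 a 0

namespace NormalForm

variable {H : Type u} [Group H] [TopologicalSpace H] (𝒩 : NormalForm.{u, v, w} H)

/-- `x₁ + x₂ ↦ f̂(x₂) + f_sing(x₁, x₂)`. -/
noncomputable def fNF (x : 𝒩.X) : 𝒩.Y :=
  (𝒩.fhat (𝒩.Coim.projectionOntoL 𝒩.Ker 𝒩.decompX x) : 𝒩.Y) + 𝒩.fsing x

theorem fNF_equivariant (h : H) (x : 𝒩.X) (hx : x ∈ 𝒩.U) :
    𝒩.fNF (𝒩.repX.toHom h x) = 𝒩.repY.toHom h (𝒩.fNF x) := by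
  have key : 𝒩.Coim.projectionOntoL 𝒩.Ker 𝒩.decompX (𝒩.repX.toHom h x) =
      ⟨𝒩.repX.toHom h (𝒩.Coim.projectionOntoL 𝒩.Ker 𝒩.decompX x),
        𝒩.coim_invariant h _ (Subtype.prop _)⟩ := by
    set P := 𝒩.Coim.projectionOntoL 𝒩.Ker 𝒩.decompX with hP
    have h1 : x - (P x : 𝒩.X) ∈ 𝒩.Ker := by
      rw [← Submodule.projectionOntoL_apply_eq_zero_iff 𝒩.decompX, map_sub,
        Submodule.projectionOntoL_apply_left, sub_self]
    have h2 := (Submodule.projectionOntoL_apply_eq_zero_iff 𝒩.decompX).2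
      (𝒩.ker_invariant h _ h1)
    rw [map_sub, map_sub, sub_eq_zero] at h2
    rw [hP, h2]
    exact Submodule.projectionOntoL_apply_left 𝒩.decompX
      ⟨𝒩.repX.toHom h (P x), 𝒩.coim_invariant h _ (P x).2⟩
  unfold fNF
  rw [key, 𝒩.fhat_equivariant, 𝒩.fsing_equivariant h x hx, map_add]

end NormalForm

/-- An abstract equivariant normal form `(H, X, Y, f̂, f_sing)`, where `H` is a compact Lie
group, given as a compact Lie subgroup of the Lie group `K`. -/
structure AbstractENF {K : Type u} [Group K] [TopologicalSpace K] [LCCharts K]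
    (H : Subgroup K) extends NormalForm.{u, v, w} H where
  compact : CompactSpace H
  lie : IsLieSubgroup H

/-! ## Associated bundles and the equivariant normal form -/

section Twisted

variable {K : Type u} [Group K]

/-- `K ×_H A`, the quotient of `K × A` by `(g, a) ∼ (g h⁻¹, h a)`, for an invariant subset `A`
of a set `F` on which `H` acts. -/
def TwistedProduct (H : Subgroup K) {F : Type v} (act : H → F → F) (A : Set F) :
    Type (max u v) :=
  Quot fun p q : K × A =>
    ∃ h : H, q.1 = p.1 * (h : K)⁻¹ ∧ (q.2 : F) = act h (p.2 : F)

/-- `id ×_H φ : K ×_H A → K ×_H B` for an equivariant map `φ : A → B`. -/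
def TwistedProduct.map {H : Subgroup K} {F : Type v} {F' : Type w} {act : H → F → F}
    {act' : H → F' → F'} {A : Set F} {B : Set F'} (φ : A → B)
    (hφ : ∀ (h : H) (a a' : A), (a' : F) = act h (a : F) →
      (φ a' : F') = act' h (φ a : F')) :
    TwistedProduct H act A → TwistedProduct H act' B :=
  Quot.map (fun p => (p.1, φ p.2)) (by
    rintro p q ⟨h, h1, h2⟩
    exact ⟨h, h1, hφ h p.2 q.2 h2⟩)

/-- `[g, a] ↦ g • j(a)` for an equivariant map `j : A → M`. -/
def TwistedProduct.orbitMap {H : Subgroup K} {F : Type v} {M : Type w} [MulAction K M]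
    {act : H → F → F} {A : Set F} (j : A → M)
    (hj : ∀ (h : H) (a a' : A), (a' : F) = act h (a : F) → j a' = h • j a) :
    TwistedProduct H act A → M :=
  Quot.lift (fun p => p.1 • j p.2) (by
    rintro p q ⟨h, h1, h2⟩
    rw [h1, hj h p.2 q.2 h2, Subgroup.smul_def, smul_smul, inv_mul_cancel_right])

end Twisted

section Charts

variable {H : Type v} {P M : Type u} [Group H] [TopologicalSpace H] [TopologicalSpace P]
  [LCCharts P] [MulAction H M] {i : P → M} {m : M} {X : LCS.{u}}
  {κ : OpenPartialHomeomorph P X} {π : LinRep H X}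

/-- The inverse of an equivariant chart is equivariant. -/
theorem IsEquivChart.symm_equivariant (hκ : IsEquivChart i m κ π) (h : H) {x x' : X}
    (hx : x ∈ κ.target) (hx' : x' = π.toHom h x) : i (κ.symm x') = h • i (κ.symm x) := by
  obtain ⟨p', hp', h1, h2⟩ := hκ.equivariant h (κ.symm x) (κ.map_target hx)
  rw [κ.right_inv hx] at h2
  rw [← h1, hx', ← h2, κ.left_inv hp']

end Charts

/-- The restriction of `f : M → N` to the invariant submanifold `S` is brought into the normal
form `𝒩` at `m` in an `H`-equivariant way: in `H`-equivariant charts `κ` of `S` at `m` and `ρ`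
of `N` at `f m` it is given by `f_NF`. -/
def RestrictionHasNormalForm {H : Type u} {M : Type v} {N : Type w} [Group H]
    [TopologicalSpace H] [TopologicalSpace M] [LCCharts M] [TopologicalSpace N] [LCCharts N]
    [MulAction H M] [MulAction H N] (f : M → N) (S : Set M) (m : M)
    (𝒩 : NormalForm.{u, v, w} H) : Prop :=
  ∃ (κ : OpenPartialHomeomorph S 𝒩.X) (ρ : OpenPartialHomeomorph N 𝒩.Y),
    IsEquivChart (Subtype.val : S → M) m κ 𝒩.repX ∧
    IsEquivChart (fun q : N => q) (f m) ρ 𝒩.repY ∧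
    κ.target = 𝒩.U ∧
    ∀ s ∈ κ.source, f s ∈ ρ.source ∧ ρ (f s) = 𝒩.fNF (κ s)

section Main

variable {K : Type u} {M : Type v} {N : Type w} [Group K] [TopologicalSpace K] [LCCharts K]
  [TopologicalSpace M] [LCCharts M] [TopologicalSpace N] [LCCharts N] [MulAction K M]
  [MulAction K N]

/-- The tube map `χ^T : K ×_H S → M`, `[g, s] ↦ g • s`. -/
def tubeMap (H : Subgroup K) (S : Set M) :
    TwistedProduct H (fun (h : H) (x : M) => h • x) S → M :=
  TwistedProduct.orbitMap (fun s : S => (s : M)) (fun _ _ _ e => e)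

/-- `id ×_H ι_S : K ×_H U → K ×_H S`, where `ι_S : U → S` is the inverse of the equivariant
chart `κ : S → U`. -/
def sliceMap {H : Subgroup K} {S : Set M} {m : M} {X : LCS.{v}} {U : Set X}
    {κ : OpenPartialHomeomorph S X} {π : LinRep H X}
    (hκ : IsEquivChart (Subtype.val : S → M) m κ π) (hU : κ.target = U) :
    TwistedProduct H (fun h x => π.toHom h x) U →
      TwistedProduct H (fun (h : H) (x : M) => h • x) S :=
  TwistedProduct.map (fun x : U => κ.symm x)
    (fun h a _ e => hκ.symm_equivariant h (hU ▸ a.2) e)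

/-- `ρ^T : K ×_H V → N`, `[g, y] ↦ g • ρ⁻¹(y)`, for an equivariant chart `ρ` with image `V`. -/
def chartMap {H : Subgroup K} {n : N} {Y : LCS.{w}}
    {ρ : OpenPartialHomeomorph N Y} {π : LinRep H Y}
    (hρ : IsEquivChart (fun q : N => q) n ρ π) :
    TwistedProduct H (fun h y => π.toHom h y) ρ.target → N :=
  TwistedProduct.orbitMap (fun y : ρ.target => ρ.symm y)
    (fun h a _ e => hρ.symm_equivariant h a.2 e)

/-- `f_NF : K ×_H U → K ×_H V`, `[g, x₁, x₂] ↦ [g, f̂(x₂) + f_sing(x₁, x₂)]`. -/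
noncomputable def normalFormMap {H : Subgroup K} (𝒩 : NormalForm.{u, v, w} H) {V : Set 𝒩.Y}
    (hV : MapsTo 𝒩.fNF 𝒩.U V) :
    TwistedProduct H (fun h x => 𝒩.repX.toHom h x) 𝒩.U →
      TwistedProduct H (fun h y => 𝒩.repY.toHom h y) V :=
  TwistedProduct.map (fun x : 𝒩.U => ⟨𝒩.fNF x, hV x.2⟩)
    (fun h a a' e => by
      change 𝒩.fNF a' = 𝒩.repY.toHom h (𝒩.fNF a)
      rw [e, 𝒩.fNF_equivariant h a a.2])

/-- `f` can be brought into the equivariant normal form `𝒩` at `m`. Here `K` plays the role of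
the stabilizer `G_μ` of `μ = f m`, and `H = K_m` that of `G_m`. The chart `κ` is the inverse of
the diffeomorphism `ι_S : U → S`. -/
def BroughtIntoENF (f : M → N) (m : M)
    (𝒩 : AbstractENF.{u, v, w} (MulAction.stabilizer K m)) : Prop :=
  ∃ S : Set M, IsSlice K m S ∧
    ∃ (κ : OpenPartialHomeomorph S 𝒩.X) (ρ : OpenPartialHomeomorph N 𝒩.Y)
      (hκ : IsEquivChart (Subtype.val : S → M) m κ 𝒩.repX)
      (hρ : IsEquivChart (fun q : N => q) (f m) ρ 𝒩.repY)
      (hU : κ.target = 𝒩.U) (hV : MapsTo 𝒩.fNF 𝒩.U ρ.target),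
      κ.source = univ ∧ MapsTo f S ρ.source ∧
      f ∘ tubeMap (MulAction.stabilizer K m) S ∘ sliceMap hκ hU =
        chartMap hρ ∘ normalFormMap 𝒩.toNormalForm hV

end Main

end LocConvex

/-!
The domain of the chart `κ` of `S` that brings `f|_S` into normal form may be smaller than the
slice `S`, so `S` is replaced by the open subset `S' = dom κ`, which is invariant under the compact group `G_m`. Since `f` is `G_μ`-equivariant,
the identity `ρ ∘ f = f_NF ∘ κ` on `S'` propagates along the orbits:
`f (g • κ⁻¹ x) = g • f (κ⁻¹ x) = g • ρ⁻¹ (f_NF x)`, which is the required identity on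
`G_μ ×_{G_m} U`. Compactness of `G_m` follows from properness, as `G_m × {m}` is the preimage of
the point `(m, m)` under `(g, x) ↦ (g • x, x)`.

The remaining point is that an open invariant subset `S'` of a slice that contains `m` and is the
domain of an equivariant chart is again a slice (`IsSlice.source_chart`). Here the smooth
structure of `S'` is the one that `S'` has as a submanifold of the ambient manifold, not the one
restricted from `S`. The two agree because every chart of `M` adapted to `S'` becomes, after its
domain is shrunk to an open set `O` with `S ∩ O = S'`, a chart adapted to `S` that induces the same
chart of `S'`; this is `isOpenPiece_subset`. Consequently all chart representations of maps from
or into `S'` are chart representations of the corresponding maps from or into `S`, and no chain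
rule for the Michal–Bastiani calculus is needed.
-/

namespace LocConvex

/-! ### Restriction to smaller domains -/

section Restriction

variable {E : Type u} {F : Type v} [AddCommGroup E] [Module ℝ E] [TopologicalSpace E]
  [AddCommGroup F] [Module ℝ F] [TopologicalSpace F]

theorem CkOn.mono {n : ℕ} {f : E → F} {A B : Set E} (hf : CkOn n f B) (h : A ⊆ B) :
    CkOn n f A := by
  induction n generalizing E F with
  | zero => exact ContinuousOn.mono hf h
  | succ n ih =>
    obtain ⟨hc, df, hd, hdf⟩ := hf
    exact ⟨hc.mono h, df, fun x hx a => hd x (h hx) a, ih hdf (prod_mono_left h)⟩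

theorem SmoothOn.mono {f : E → F} {A B : Set E} (hf : SmoothOn f B) (h : A ⊆ B) :
    SmoothOn f A :=
  fun n => (hf n).mono h

end Restriction

theorem IsChart.restrOpen {M : Type u} [TopologicalSpace M] [LCCharts M] {X : LCS.{u}}
    {κ : OpenPartialHomeomorph M X} (hκ : IsChart X κ) (O : Set M) (hO : IsOpen O) :
    IsChart X (κ.restrOpen O hO) := by
  intro c hc
  refine ⟨(hκ c hc).1.mono ?_, (hκ c hc).2.mono ?_⟩
  · rintro x ⟨hx, hx'⟩
    exact ⟨hx.1, hx'⟩
  · rintro x ⟨hx, hx'⟩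
    exact ⟨hx, hx'.1⟩

theorem IsAdapted.restrOpen {M : Type u} [TopologicalSpace M] [LCCharts M] {S S' O : Set M}
    {κ : LCChart M} {Y : Submodule ℝ κ.model} (hκ : IsAdapted S κ Y) (hO : IsOpen O)
    (h : S ∩ O = S' ∩ O) : IsAdapted S' ⟨κ.model, κ.map.restrOpen O hO⟩ Y := by
  obtain ⟨h1, h2, h3⟩ := hκ
  refine ⟨h1.restrOpen O hO, h2, ?_⟩
  ext y
  constructor
  · rintro ⟨x, ⟨hx, hxS'⟩, rfl⟩
    have hxS : x ∈ S := (h.symm ▸ (⟨hxS', hx.2⟩ : x ∈ S' ∩ O) : x ∈ S ∩ O).1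
    exact ⟨(κ.map.restrOpen O hO).map_source hx,
      (h3 ▸ mem_image_of_mem κ.map ⟨hx.1, hxS⟩ : κ.map x ∈ κ.map.target ∩ (Y : Set _)).2⟩
  · rintro ⟨hy, hyY⟩
    have hy' := (κ.map.restrOpen O hO).map_target hy
    obtain ⟨x, ⟨hx, hxS⟩, rfl⟩ := h3.symm.subset ⟨hy.1, hyY⟩
    have hxO : x ∈ O := by
      have := hy'.2
      rwa [show (κ.map.restrOpen O hO).symm (κ.map x) = x from κ.map.left_inv hx] at this
    exact ⟨x, ⟨⟨hx, hxO⟩, (h ▸ (⟨hxS, hxO⟩ : x ∈ S ∩ O) : x ∈ S' ∩ O).1⟩, rfl⟩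

/-! ### Open pieces of a manifold -/

/-- The open embedding `e : P → Q` identifies the charts of `P` with charts of `Q` whose domain
is contained in the image of `e`, so that `P` is an open submanifold of `Q`. The embedding is
encoded as a partial homeomorphism in order to have its partial inverse at hand. -/
structure IsOpenPiece {P Q : Type u} [TopologicalSpace P] [LCCharts P] [TopologicalSpace Q]
    [LCCharts Q] (e : OpenPartialHomeomorph P Q) : Prop where
  source_eq : e.source = univ
  charts_mem : ∀ σ ∈ LCCharts.charts (M := P),
    (⟨σ.model, e.symm.trans σ.map⟩ : LCChart Q) ∈ LCCharts.charts (M := Q)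

namespace IsOpenPiece

variable {P Q : Type u} [TopologicalSpace P] [LCCharts P] [TopologicalSpace Q] [LCCharts Q]
  {e : OpenPartialHomeomorph P Q}

theorem mem_source (he : IsOpenPiece e) (p : P) : p ∈ e.source :=
  he.source_eq ▸ mem_univ p

theorem mem_target (he : IsOpenPiece e) (p : P) : e p ∈ e.target :=
  e.map_source (he.mem_source p)

theorem left_inv (he : IsOpenPiece e) (p : P) : e.symm (e p) = p :=
  e.left_inv (he.mem_source p)

protected theorem continuous (he : IsOpenPiece e) : Continuous e :=
  continuousOn_univ.1 (he.source_eq ▸ e.continuousOn)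

theorem isChart_trans (he : IsOpenPiece e) {X : LCS.{u}} {κ : OpenPartialHomeomorph Q X}
    (hκ : IsChart X κ) : IsChart X (e.trans κ) := by
  intro σ hσ
  obtain ⟨h1, h2⟩ := hκ _ (he.charts_mem σ hσ)
  refine ⟨h1.mono ?_, h2.mono ?_⟩
  · rintro x ⟨hx, hx'⟩
    exact ⟨hx.1, hx.2, hx'⟩
  · rintro x ⟨hx, hx'⟩
    exact ⟨⟨hx, he.mem_source _⟩, hx'.2⟩

theorem isSubmanifold_preimage (he : IsOpenPiece e) {T : Set Q} (hT : IsSubmanifold T) :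
    IsSubmanifold (e ⁻¹' T) := by
  intro p hp
  obtain ⟨κ, Y, hpκ, h1, h2, h3⟩ := hT (e p) hp
  refine ⟨⟨κ.model, e.trans κ.map⟩, Y, ⟨he.mem_source p, hpκ⟩, he.isChart_trans h1, h2, ?_⟩
  ext y
  constructor
  · rintro ⟨x, ⟨hx, hxT⟩, rfl⟩
    exact ⟨(e.trans κ.map).map_source hx, (h3.subset ⟨e x, ⟨hx.2, hxT⟩, rfl⟩).2⟩
  · rintro ⟨hy, hyY⟩
    obtain ⟨q, ⟨hq, hqT⟩, rfl⟩ := h3.ge ⟨hy.1, hyY⟩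
    have hqe : q ∈ e.target := by
      have := hy.2
      rwa [mem_preimage, κ.map.left_inv hq] at this
    have hr := e.right_inv hqe
    refine ⟨e.symm q, ⟨⟨he.mem_source _, ?_⟩, ?_⟩, ?_⟩
    · change e (e.symm q) ∈ κ.map.source
      rwa [hr]
    · change e (e.symm q) ∈ T
      rwa [hr]
    · change κ.map (e (e.symm q)) = _
      rw [hr]

/-- A diffeomorphism from an open subset of `R × Q` restricts to the open piece `R × P`. -/
theorem isDiffeoOn_prod (he : IsOpenPiece e) {R : Type v} {M : Type w} [TopologicalSpace R]
    [LCCharts R] [TopologicalSpace M] [LCCharts M] {Φ : R × Q → M} {A : Set R} {V : Set M}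
    (h : IsDiffeoOn Φ (A ×ˢ (univ : Set Q)) V) :
    IsDiffeoOn (fun p : R × P => Φ (p.1, e p.2)) (A ×ˢ (univ : Set P))
      (Φ '' (A ×ˢ e.target)) := by
  obtain ⟨hA, hV, ⟨hΦc, hΦ⟩, hΦV, g, ⟨hgc, hg⟩, hgA, hl, hr⟩ := h
  have himage : Φ '' (A ×ˢ e.target) = V ∩ g ⁻¹' (univ ×ˢ e.target) := by
    ext x
    constructor
    · rintro ⟨p, hp, rfl⟩
      have hp' : p ∈ A ×ˢ (univ : Set Q) := ⟨hp.1, mem_univ _⟩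
      refine ⟨hΦV hp', ?_⟩
      rw [mem_preimage, hl hp']
      exact ⟨mem_univ _, hp.2⟩
    · rintro ⟨hx, hx'⟩
      exact ⟨g x, ⟨(hgA hx).1, hx'.2⟩, hr hx⟩
  refine ⟨?_, ?_, ⟨?_, ?_⟩, ?_, fun x => ((g x).1, e.symm (g x).2), ⟨?_, ?_⟩, ?_, ?_, ?_⟩
  · have h' : Continuous fun p : R × P => (p.1, e p.2) :=
      continuous_fst.prodMk (he.continuous.comp continuous_snd)
    convert hA.preimage h' using 1
    ext p
    simp
  · rw [himage]
    exact hgc.isOpen_inter_preimage hV (isOpen_univ.prod e.open_target)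
  · refine hΦc.comp (t := A ×ˢ univ)
      (continuous_fst.prodMk (he.continuous.comp continuous_snd)).continuousOn ?_
    exact fun p hp => ⟨hp.1, mem_univ _⟩
  · rintro _ ⟨c, hc, σ, hσ, rfl⟩ d hd
    -- The chart `σ` of `P` and its push-forward to `Q` give the same chart representation.
    refine (hΦ _ ⟨c, hc, _, he.charts_mem σ hσ, rfl⟩ d hd).mono ?_
    rintro x ⟨hx, hx', hx''⟩
    exact ⟨⟨hx.1, hx.2, he.mem_source _⟩, ⟨hx'.1, mem_univ _⟩, hx''⟩
  · exact fun p hp => ⟨(p.1, e p.2), ⟨hp.1, he.mem_target _⟩, rfl⟩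
  · rw [himage]
    have h1 : ContinuousOn g (V ∩ g ⁻¹' (univ ×ˢ e.target)) := hgc.mono inter_subset_left
    exact (continuous_fst.comp_continuousOn h1).prodMk
      (e.continuousOn_symm.comp (continuous_snd.comp_continuousOn h1) fun x hx => hx.2.2)
  · rintro d hd _ ⟨c, hc, σ, hσ, rfl⟩
    refine (hg d hd _ ⟨c, hc, _, he.charts_mem σ hσ, rfl⟩).mono ?_
    rw [himage]
    rintro x ⟨hx, hx', hx''⟩
    exact ⟨hx, hx'.1, hx''.1, hx'.2.2, hx''.2⟩
  · rw [himage]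
    exact fun x hx => ⟨(hgA hx.1).1, mem_univ _⟩
  · intro p hp
    have := hl (show (p.1, e p.2) ∈ A ×ˢ (univ : Set Q) from ⟨hp.1, mem_univ _⟩)
    simp only [this, he.left_inv]
  · rw [himage]
    intro x hx
    change Φ ((g x).1, e (e.symm (g x).2)) = x
    rw [e.right_inv hx.2.2]
    exact hr hx.1

end IsOpenPiece

/-! ### Open subsets of submanifolds -/

section Subset

variable {M : Type u} [TopologicalSpace M] [LCCharts M]

theorem IsSubmanifold.inter_isOpen {S O : Set M} (hS : IsSubmanifold S) (hO : IsOpen O) :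
    IsSubmanifold (S ∩ O) := by
  intro s hs
  obtain ⟨κ, Y, hsκ, hκ⟩ := hS s hs.1
  exact ⟨⟨κ.model, κ.map.restrOpen O hO⟩, Y, ⟨hsκ, hs.2⟩,
    hκ.restrOpen hO (by rw [inter_assoc, inter_self])⟩

/-- The relatively open subset `S ∩ O` of `S`, with the smooth structure that it inherits from
`M`, is an open piece of `S`: an adapted chart of `S ∩ O` is, restricted to `O`, adapted to `S`. -/
theorem isOpenPiece_subset {S S' O : Set M} (hO : IsOpen O) (hS' : S' = S ∩ O)
    (e : OpenPartialHomeomorph S' S) (he : e.source = univ) (hval : ∀ s, (e s : M) = s) :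
    IsOpenPiece e := by
  refine ⟨he, ?_⟩
  rintro σ ⟨κ, Y, hκ, hsrc, L, hL⟩
  rw [Subtype.range_coe] at hκ
  have hsymm : ∀ s ∈ e.target, ((e.symm s : S') : M) = s := fun s hs => by
    rw [← hval, e.right_inv hs]
  have htarget : ∀ s : S, (s : M) ∈ O → s ∈ e.target := fun s hs => by
    have hs' : (s : M) ∈ S' := hS' ▸ ⟨s.2, hs⟩
    have h : e ⟨s, hs'⟩ = s := Subtype.ext (hval _)
    exact h ▸ e.map_source (he ▸ mem_univ _)
  refine ⟨⟨κ.model, κ.map.restrOpen O hO⟩, Y, ?_, ?_, L, ?_⟩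
  · rw [Subtype.range_coe]
    exact hκ.restrOpen hO (by rw [hS', inter_assoc, inter_self])
  · ext s
    constructor
    · rintro ⟨hs, hs'⟩
      have h1 : e.symm s ∈ Subtype.val ⁻¹' κ.map.source := hsrc ▸ hs'
      rw [mem_preimage, hsymm s hs] at h1
      refine ⟨h1, ?_⟩
      have h2 : ((e.symm s : S') : M) ∈ S ∩ O := hS' ▸ (e.symm s).2
      exact (hsymm s hs) ▸ h2.2
    · rintro ⟨hs, hsO⟩
      refine ⟨htarget s hsO, ?_⟩
      change e.symm s ∈ σ.map.source
      rw [hsrc, mem_preimage, hsymm s (htarget s hsO)]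
      exact hs
  · rintro s ⟨hs, hs'⟩
    exact (hL (e.symm s) hs').trans (congrArg κ.map (hsymm s hs))

/-- The inclusion into `S` of an open subset of `S`, regarded as a subset of `M`. -/
theorem exists_isOpenPiece {S : Set M} {W : Set S} (hW : IsOpen W) (hne : W.Nonempty) :
    ∃ e : OpenPartialHomeomorph (Subtype.val '' W : Set M) S, IsOpenPiece e ∧
      (∀ s, (e s : M) = s) ∧ e.target = W := by
  obtain ⟨O, hO, rfl⟩ := isOpen_induced_iff.1 hW
  set S' : Set M := Subtype.val '' (Subtype.val ⁻¹' O : Set S) with hS'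
  have hS'O : S' = S ∩ O := Subtype.image_preimage_coe S O
  have hsub : S' ⊆ S := hS'O ▸ inter_subset_left
  have hrange : range (Set.inclusion hsub) = Subtype.val ⁻¹' O := by
    ext s
    rw [Set.range_inclusion, hS'O]
    exact ⟨fun h => h.2, fun h => ⟨s.2, h⟩⟩
  have hemb : IsOpenEmbedding (Set.inclusion hsub) :=
    ⟨IsEmbedding.inclusion hsub, hrange ▸ hW⟩
  have : Nonempty S' := (hne.image _).to_subtype
  refine ⟨hemb.toOpenPartialHomeomorph, ?_, fun _ => rfl, ?_⟩
  · exact isOpenPiece_subset hO hS'O _ rfl fun _ => rfl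
  · rw [hemb.toOpenPartialHomeomorph_target, hrange]

end Subset

/-! ### Shrinking a slice -/

section Slice

variable {K : Type v} {M : Type u} [Group K] [TopologicalSpace K] [LCCharts K]
  [TopologicalSpace M] [LCCharts M] [MulAction K M] {m : M} {S : Set M}

/-- An equivariant chart `κ` of `S` at `m` is an equivariant chart of the open piece of
`S` given by its domain. -/
theorem IsEquivChart.trans_isOpenPiece {H : Type v} [Group H] [TopologicalSpace H]
    [MulAction H M] {X : LCS.{u}} {κ : OpenPartialHomeomorph S X} {π : LinRep H X}
    (hκ : IsEquivChart (Subtype.val : S → M) m κ π) {S' : Set M}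
    {e : OpenPartialHomeomorph S' S} (he : IsOpenPiece e) (hval : ∀ s, (e s : M) = s)
    (htarget : e.target = κ.source) :
    IsEquivChart (Subtype.val : S' → M) m (e.trans κ) π := by
  have lift : ∀ p ∈ κ.source, ∃ p' ∈ (e.trans κ).source, e p' = p := fun p hp => by
    have hr := e.right_inv (htarget.ge hp)
    refine ⟨e.symm p, ⟨he.mem_source _, ?_⟩, hr⟩
    change e (e.symm p) ∈ κ.source
    rwa [hr]
  refine ⟨he.isChart_trans hκ.isChart, ?_, ?_⟩
  · obtain ⟨p, hp, hpm, hp0⟩ := hκ.base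
    obtain ⟨p', hp', rfl⟩ := lift p hp
    exact ⟨p', hp', (hval p').symm.trans hpm, hp0⟩
  · intro h p hp
    obtain ⟨q, hq, hq1, hq2⟩ := hκ.equivariant h (e p) hp.2
    obtain ⟨q', hq', rfl⟩ := lift q hq
    refine ⟨q', hq', ?_, hq2⟩
    rw [← hval q', hq1, hval p]

/-- The domain of an equivariant chart of a slice is again a slice. -/
theorem IsSlice.source_chart (hS : IsSlice K m S) {X : LCS.{u}}
    {κ : OpenPartialHomeomorph S X} {π : LinRep (MulAction.stabilizer K m) X}
    (hκ : IsEquivChart (Subtype.val : S → M) m κ π) :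
    IsSlice K m (Subtype.val '' κ.source) := by
  obtain ⟨p₀, hp₀, hp₀m, -⟩ := id hκ.base
  obtain ⟨e, he, hval, htarget⟩ := exists_isOpenPiece κ.open_source ⟨p₀, hp₀⟩
  refine ⟨⟨p₀, hp₀, hp₀m⟩, ?_, ?_, ?_, ?_, ?_, ?_⟩
  · obtain ⟨O, hO, hOκ⟩ := isOpen_induced_iff.1 κ.open_source
    rw [← hOκ, Subtype.image_preimage_coe]
    exact hS.submanifold.inter_isOpen hO
  · rintro g hg _ ⟨s, hs, rfl⟩
    obtain ⟨s', hs', h, -⟩ := hκ.equivariant ⟨g, hg⟩ s hs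
    exact ⟨s', hs', h⟩
  · rintro g ⟨_, ⟨s, hs, rfl⟩, s', hs', h⟩
    exact hS.mem_stabilizer g ⟨s, s.2, h ▸ s'.2⟩
  · obtain ⟨lc, hprin, U, χ, V, hU, h1U, hχ, hsec, -, hdiff⟩ := hS.local_section
    have hdiff' := he.isDiffeoOn_prod hdiff
    simp only [hval] at hdiff'
    refine ⟨lc, hprin, U, χ, _, hU, h1U, hχ, hsec, ?_, hdiff'⟩
    -- `m` is the image of `([e], χ([e])⁻¹ • m)`, and `χ([e])` stabilizes `m`.
    have hstab : (χ ((1 : K) : K ⧸ MulAction.stabilizer K m))⁻¹ ∈ MulAction.stabilizer K m := by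
      have := QuotientGroup.eq.1 (hsec _ h1U)
      rwa [mul_one] at this
    refine ⟨(((1 : K) : K ⧸ MulAction.stabilizer K m), p₀), ⟨h1U, htarget.ge hp₀⟩, ?_⟩
    change χ _ • (p₀ : M) = m
    rw [hp₀m]
    exact inv_mem_iff.1 hstab
  · obtain ⟨hTc, hTs⟩ := hS.partial_slice
    have h1 := hTc.preimage he.continuous
    have h2 := he.isSubmanifold_preimage hTs
    simp only [preimage_ofPred_eq, hval] at h1 h2
    exact ⟨h1, h2⟩
  · refine ⟨X, e.trans κ, π, ?_, hκ.trans_isOpenPiece he hval htarget⟩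
    refine eq_univ_of_forall fun p => ⟨he.mem_source p, ?_⟩
    exact htarget.le (he.mem_target p)

end Slice

/-! ### The equivariant normal form -/

/-- Stabilizers of a proper action are compact. -/
theorem IsProperAction.compactSpace_stabilizer {K : Type u} {M : Type v} [Group K]
    [TopologicalSpace K] [TopologicalSpace M] [MulAction K M] (h : IsProperAction K M) (m : M) :
    CompactSpace (MulAction.stabilizer K m) := by
  have h1 := (h {(m, m)} isCompact_singleton).image continuous_fst
  refine isCompact_iff_compactSpace.1 ?_
  convert h1 using 1
  ext g
  constructor
  · exact fun hg => ⟨(g, m), Prod.ext hg rfl, rfl⟩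
  · rintro ⟨⟨g', x⟩, hx, rfl⟩
    obtain ⟨hx1, rfl⟩ := Prod.ext_iff.1 hx
    exact hx1

/-- If the restriction of an equivariant map `f` to a slice `S` of a proper action has a normal
form, then `f` itself can be brought into the corresponding equivariant normal form, with the
slice shrunk to the domain of the chart of `S`. -/
theorem broughtIntoENF_of_slice {K : Type u} {M : Type v} {N : Type w} [Group K]
    [TopologicalSpace K] [LCCharts K] [TopologicalSpace M] [LCCharts M] [TopologicalSpace N]
    [LCCharts N] [MulAction K M] [MulAction K N] {f : M → N}
    (hf : ∀ (g : K) (x : M), f (g • x) = g • f x) {m : M} {S : Set M} (hS : IsSlice K m S)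
    (𝒩 : AbstractENF.{u, v, w} (MulAction.stabilizer K m))
    (h : RestrictionHasNormalForm f S m 𝒩.toNormalForm) : BroughtIntoENF f m 𝒩 := by
  obtain ⟨κ, ρ, hκ, hρ, hU, hfκ⟩ := h
  obtain ⟨p₀, hp₀, -, -⟩ := id hκ.base
  obtain ⟨e, he, hval, htarget⟩ := exists_isOpenPiece κ.open_source ⟨p₀, hp₀⟩
  have hsource : (e.trans κ).source = univ :=
    eq_univ_of_forall fun p => ⟨he.mem_source p, htarget.le (he.mem_target p)⟩
  have hU' : (e.trans κ).target = 𝒩.U := by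
    rw [e.trans_target, ← hU]
    exact inter_eq_left.2 fun x hx => htarget.ge (κ.map_target hx)
  have hfNF : ∀ x ∈ 𝒩.U, f (κ.symm x) ∈ ρ.source ∧ ρ (f (κ.symm x)) = 𝒩.fNF x := fun x hx => by
    rw [← hU] at hx
    have := hfκ _ (κ.map_target hx)
    rwa [κ.right_inv hx] at this
  have hV : MapsTo 𝒩.fNF 𝒩.U ρ.target := fun x hx =>
    (hfNF x hx).2 ▸ ρ.map_source (hfNF x hx).1
  refine ⟨_, hS.source_chart hκ, e.trans κ, ρ, hκ.trans_isOpenPiece he hval htarget, hρ, hU', hV,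
    hsource, ?_, ?_⟩
  · rintro _ ⟨s, hs, rfl⟩
    exact (hfκ s hs).1
  · funext z
    induction z using Quot.ind with
    | mk z =>
      obtain ⟨g, x⟩ := z
      change f (g • (((e.trans κ).symm x : _) : M)) = g • ρ.symm (𝒩.fNF x)
      have hx : κ.symm (x : 𝒩.X) ∈ e.target := by
        rw [htarget]
        exact κ.map_target (hU.ge x.2)
      have h1 : (((e.trans κ).symm x : _) : M) = κ.symm (x : 𝒩.X) := by
        rw [← hval]
        exact congrArg Subtype.val (e.right_inv hx)
      rw [hf, h1, ← (hfNF x x.2).2, ρ.left_inv (hfNF x x.2).1]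

end LocConvex

/-- Equivariant normal form theorem, general version. The stabilizer of `m` in the stabilizer
`G_μ` of `μ = f m` is `G_m`, since `G_m ⊆ G_μ` by equivariance of `f`. -/
theorem theorem3p1p6 {G : Type u} {M : Type v} {N : Type w}
    [Group G] [TopologicalSpace G] [LocConvex.LCCharts G]
    [TopologicalSpace M] [LocConvex.LCCharts M]
    [TopologicalSpace N] [LocConvex.LCCharts N]
    [MulAction G M] [MulAction G N]
    (hG : LocConvex.IsLieGroup G)
    (hM : LocConvex.IsFrechetManifold M) (hN : LocConvex.IsFrechetManifold N)
    (hGM : LocConvex.IsSmoothAction G M) (hGN : LocConvex.IsSmoothAction G N)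
    (f : M → N) (hf : LocConvex.SmoothMap f) (hfG : ∀ (g : G) (x : M), f (g • x) = g • f x)
    (m : M)
    (hLie : LocConvex.IsLieSubgroup (MulAction.stabilizer G (f m)))
    (hproper : LocConvex.IsProperAction (MulAction.stabilizer G (f m)) M)
    (S : Set M) (hS : LocConvex.IsSlice (MulAction.stabilizer G (f m)) m S)
    (hlin : LocConvex.IsLinearizableAt
      (MulAction.stabilizer (MulAction.stabilizer G (f m)) m) (f m))
    (hnf : ∃ 𝒩 : LocConvex.NormalForm.{u, v, w}
        (MulAction.stabilizer (MulAction.stabilizer G (f m)) m),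
      LocConvex.RestrictionHasNormalForm f S m 𝒩) :
    ∃ 𝒩 : LocConvex.AbstractENF.{u, v, w}
        (MulAction.stabilizer (MulAction.stabilizer G (f m)) m),
      LocConvex.BroughtIntoENF f m 𝒩 := by
  obtain ⟨𝒩, h𝒩⟩ := hnf
  obtain ⟨_, hprincipal, -⟩ := hS.local_section
  exact ⟨⟨𝒩, hproper.compactSpace_stabilizer m, hprincipal.lie⟩,
    LocConvex.broughtIntoENF_of_slice
      (K := MulAction.stabilizer G (f m)) (fun g x => hfG g x) hS _ h𝒩⟩
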